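/- **Setting.** For each $n\in\mathbb N_0$ let $X_n,A_n$ be complete separable metric spaces, $S_n$ a topological space with its Borel $\sigma$-algebra, $(\Omega^n,\mathcal G^n,\mathbb P^n)$ an atomless probability space and $\xi_n:\Omega^n\to S_n$ measurable. Let $A_n(x)\subset A_n$ be the set of admissible actions in $x\in X_n$, $\mathbb K_n=\{(x,a):x\in X_n,\ a\in A_n(x)\}$, $c_n:\mathbb K_n\to[0,\infty)$ the cost and $F_n:\mathbb K_n\times S_n\to X_{n+1}$ a continuous map. The state process is $x_{n+1}=F_n(x_n,a_n,\xi_n)$, with independent noises (defined on the product space $(\prod_n\Omega^n,\mathbb P=\bigotimes_n\mathbb P^n)$), and $Q_{n+1}(\cdot\mid x,a)$ denotes the law of $F_n(x,a,\xi_n)$. A policy is a sequence $\pi=(\pi_n)$ of measurable maps $\pi_n:X_n\to A_n$ with $\pi_n(x)\in A_n(x)$ for all $x\in X_n$. Let $\mathcal Z_n$ be the set of measurable functions $\mathbb K_n\to\mathbb R$ and $\mathcal Z_{n+1}^{\,n}$ the set of measurable $Z:\mathbb K_n\times\Omega^n\to\mathbb R$ with $Z(k,\cdot)\in L^1(\mathbb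 P^n)$ for every $k\in\mathbb K_n$. A one-step conditional risk mapping $\rho_n:\mathcal Z^{\,n}_{n+1}\to\mathcal Z_n$ is a map that is convex, monotone ($Z(k,\cdot)\le Z'(k,\cdot)$ a.s. for all $k$ implies $\rho_n(Z)\le\rho_n(Z')$), and satisfies $\rho_n(Z+Y)=\rho_n(Z)+Y$ for $Y\in\mathcal Z_n$ and $\rho_n(\lambda Z)=\lambda\rho_n(Z)$ for $0\le\lambda\in\mathcal Z_n$. It is law invariant if $\rho_n(Z)(k)=\rho_n(Z')(k')$ whenever $Z(k,\cdot)$ and $Z'(k',\cdot)$ have the same law under $\mathbb P^n$. For $[0,\infty]$-valued $Z$ put $\rho_n(Z)(k)=\sup\{\rho_n(Y)(k): Y\in\mathcal Z^{\,n}_{n+1},\ 0\le Y(k,\cdot)\le Z(k,\cdot)\text{ a.s.}\}$, which agrees with $\rho_n$ on nonnegative elements of $\mathcal Z^{\,n}_{n+1}$. For measurable $v:X_{n+1}\to[0,\infty]$, $\rho_n(v(x_{n+1}))$ at $(x,a)$ is the value at $(x,a)$ of $\rho_n$ on $((x,a),\omega)\mapsto v(F_n(x,a,\xi_n(\omega)))$.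 Let a law-invariant one-step conditional risk mapping $\rho_n$ be given for each $n$, let $0<\gamma<1$ and $x_0\in X_0$. For a policy $\pi$, $n\in\mathbb N_0$ and $x_n\in X_n$, with $a_t=\pi_t(x_t)$, put $$V_n(x_n,\pi)=\lim_{N\to\infty}\Big(c_n(x_n,a_n)+\gamma\rho_n\big(c_{n+1}(x_{n+1},a_{n+1})+\gamma\rho_{n+1}(\cdots+\gamma\rho_{N-1}(c_N(x_N,a_N)))\big)\Big)\in[0,\infty].$$ The policy $\pi$ is admissible, $\pi\in\Pi_{\mathrm{ad}}$, if for every $n\ge0$, $V_n(x_n,\pi)<\infty$ $\mathbb P$-a.s., where $(x_n)$ is the state process started at $x_0$ under $\pi$. Put $V_n^*(x)=\inf_{\pi\in\Pi_{\mathrm{ad}}}V_n(x,\pi)$. **Theorem.** Assume that for every $n$: * the transition law is weakly continuous: $(x,a)\mapsto\int u(y)\,Q_{n+1}(dy\mid x,a)$ is continuous on $\mathbb K_n$ for every bounded continuous $u:X_{n+1}\to\mathbb R$; * $c_n$ is lower semicontinuous on $\mathbb K_n$; * $A_n(x)$ is compact for every $x\in X_n$, and $x\mapsto A_n(x)$ is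 upper semicontinuous, i.e. for every $x$ and every open $U\supset A_n(x)$ one has $A_n(y)\subset U$ for all $y$ in a neighbourhood of $x$; and that there is a policy $\pi\in\Pi_{\mathrm{ad}}$ with $V_0(x_0,\pi)<\infty$. Then: (a) $(V_n^*)_{n\ge0}$ is the pointwise minimal solution of the optimality equations: the functions $V_n^*$ are measurable, $$V_n^*(x)=\inf_{a\in A_n(x)}\big[c_n(x,a)+\gamma\rho_n(V_{n+1}^*(x_{n+1}))\big]\qquad\text{for all }n\ge0,\ x\in X_n,$$ and whenever measurable functions $v_n:X_n\to[0,\infty]$ satisfy $v_n(x)=\inf_{a\in A_n(x)}[c_n(x,a)+\gamma\rho_n(v_{n+1}(x_{n+1}))]$ for all $n$ and $x\in X_n$, then $V_n^*\le v_n$ for all $n$. (b) There is a (deterministic Markov) policy $\pi^*\in\Pi_{\mathrm{ad}}$ attaining the minimum at every stage: $V_n^*(x)=c_n(x,\pi_n^*(x))+\gamma\rho_n(V_{n+1}^*(x_{n+1}))$ (with $x_{n+1}=F_n(x,\pi^*_n(x),\xi_n)$) for all $n\ge0$ and $x\in X_n$; and $\pi^*$ is optimal: $V_n(x,\pi^*)=V_n^*(x)$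 for all $n\ge0$ and $x\in X_n$. -/

import Mathlib

open MeasureTheory Filter Topology
open scoped NNReal ENNReal

noncomputable section

namespace RobustControl

/-! ### One-step conditional risk mappings -/

/-- A measure is atomless if every measurable set of positive measure contains a measurable
subset of strictly smaller positive measure. -/
def Atomless {Ω : Type*} [MeasurableSpace Ω] (P : Measure Ω) : Prop :=
  ∀ s, MeasurableSet s → 0 < P s → ∃ t, t ⊆ s ∧ MeasurableSet t ∧ 0 < P t ∧ P t < P s

section Risk

variable {H Ω : Type*} [MeasurableSpace H] [MeasurableSpace Ω]

/-- The space of next-stage random variables. A point `h : H` is the information that is available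
now, `ω : Ω` is the new noise with law `P`, so that the law of `Z h` under `P` is the conditional
law of `Z` given `h`. The elements are the measurable `Z` whose conditional first absolute moment
is finite. The present-stage random variables are the measurable functions `H → ℝ`. -/
def NextL1 (H : Type*) {Ω : Type*} [MeasurableSpace H] [MeasurableSpace Ω] (P : Measure Ω) :
    Set (H → Ω → ℝ) :=
  {Z | Measurable (Function.uncurry Z) ∧ ∀ h, Integrable (Z h) P}

/-- A one-step conditional risk mapping: a map from next-stage random variables to present-stage
random variables that is convex, monotone, translation equivariant with respect to present-stage
random variables, and positively homogeneous with respect to nonnegative present-stage random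
variables. Only the values of `toFun` on `NextL1 H P` are meaningful. -/
structure CondRiskMapping (H : Type*) {Ω : Type*} [MeasurableSpace H] [MeasurableSpace Ω]
    (P : Measure Ω) where
  toFun : (H → Ω → ℝ) → H → ℝ
  measurable_toFun : ∀ Z ∈ NextL1 H P, Measurable (toFun Z)
  convex : ∀ Z ∈ NextL1 H P, ∀ Z' ∈ NextL1 H P, ∀ t : ℝ, 0 ≤ t → t ≤ 1 →
    ∀ h, toFun (fun h ω => t * Z h ω + (1 - t) * Z' h ω) h ≤ t * toFun Z h + (1 - t) * toFun Z' h
  mono : ∀ Z ∈ NextL1 H P, ∀ Z' ∈ NextL1 H P, (∀ h, ∀ᵐ ω ∂P, Z h ω ≤ Z' h ω) →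
    ∀ h, toFun Z h ≤ toFun Z' h
  translation : ∀ Z ∈ NextL1 H P, ∀ Y : H → ℝ, Measurable Y →
    ∀ h, toFun (fun h ω => Z h ω + Y h) h = toFun Z h + Y h
  homogeneous : ∀ Z ∈ NextL1 H P, ∀ l : H → ℝ, Measurable l → (∀ h, 0 ≤ l h) →
    ∀ h, toFun (fun h ω => l h * Z h ω) h = l h * toFun Z h

namespace CondRiskMapping

variable {P : Measure Ω}

/-- Law invariance: the value of the risk of `Z` at the information `h` depends only on the
conditional law of `Z` given `h`. -/
def LawInvariant (ρ : CondRiskMapping H P) : Prop :=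
  ∀ Z ∈ NextL1 H P, ∀ Z' ∈ NextL1 H P, ∀ h h',
    P.map (Z h) = P.map (Z' h') → ρ.toFun Z h = ρ.toFun Z' h'

/-- The value at `h` of the risk mapping on a random variable `Z` with values in `[0, ∞]`, not
necessarily integrable: the supremum of the risks of the integrable random variables between `0`
and `Z`. On nonnegative elements of `NextL1 H P` this is the original value (`eval_ofReal`). -/
def eval (ρ : CondRiskMapping H P) (Z : H → Ω → ℝ≥0∞) (h : H) : ℝ≥0∞ :=
  ⨆ (Y : H → Ω → ℝ) (_ : Y ∈ NextL1 H P)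
    (_ : ∀ᵐ ω ∂P, 0 ≤ Y h ω ∧ ENNReal.ofReal (Y h ω) ≤ Z h ω), ENNReal.ofReal (ρ.toFun Y h)

lemma eval_mono (ρ : CondRiskMapping H P) {Z Z' : H → Ω → ℝ≥0∞} {h : H}
    (hZ : ∀ᵐ ω ∂P, Z h ω ≤ Z' h ω) : ρ.eval Z h ≤ ρ.eval Z' h := by
  refine iSup_mono fun Y => iSup_mono fun _ => iSup_le fun h2 => ?_
  refine le_iSup_of_le ?_ le_rfl
  filter_upwards [h2, hZ] with ω h3 h4 using ⟨h3.1, h3.2.trans h4⟩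

lemma eval_ofReal [MeasurableSingletonClass H] (ρ : CondRiskMapping H P) {Z : H → Ω → ℝ}
    (hZ : Z ∈ NextL1 H P) {h : H} (h0 : ∀ᵐ ω ∂P, 0 ≤ Z h ω) :
    ρ.eval (fun h ω => ENNReal.ofReal (Z h ω)) h = ENNReal.ofReal (ρ.toFun Z h) := by
  classical
  apply le_antisymm
  · refine iSup_le fun Y => iSup_le fun hY => iSup_le fun hle => ENNReal.ofReal_le_ofReal ?_
    let l : H → ℝ := Set.indicator {h} (fun _ => 1)
    have hl : Measurable l := measurable_const.indicator (measurableSet_singleton h)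
    have hl0 : ∀ h', 0 ≤ l h' := fun h' => Set.indicator_nonneg (fun _ _ => zero_le_one) _
    have hlh : l h = 1 := by simp [l]
    have hmem : ∀ W ∈ NextL1 H P, (fun h' ω => l h' * W h' ω) ∈ NextL1 H P := fun W hW =>
      ⟨(hl.comp measurable_fst).mul hW.1, fun h' => (hW.2 h').const_mul _⟩
    have key := ρ.mono _ (hmem Y hY) _ (hmem Z hZ) (fun h' => by
      by_cases hh : h' = h
      · subst hh
        filter_upwards [hle, h0] with ω h1 h2
        have := (ENNReal.ofReal_le_ofReal_iff h2).1 h1.2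
        simpa [hlh] using this
      · have : l h' = 0 := by simp [l, hh]
        simp [this]) h
    rwa [ρ.homogeneous Y hY l hl hl0, ρ.homogeneous Z hZ l hl hl0, hlh, one_mul, one_mul] at key
  · refine le_iSup_of_le Z (le_iSup_of_le hZ (le_iSup_of_le ?_ le_rfl))
    filter_upwards [h0] with ω h1 using ⟨h1, le_rfl⟩

end CondRiskMapping

end Risk

/-! ### The controlled Markov chain -/

/-- The control model with state spaces `X n`, action spaces `A n`, noise spaces `S n` and
probability spaces `Ω n`. -/
structure ControlModel (X A S Ω : ℕ → Type*)
    [∀ n, TopologicalSpace (X n)] [∀ n, TopologicalSpace (A n)]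
    [∀ n, TopologicalSpace (S n)] [∀ n, MeasurableSpace (S n)]
    [∀ n, MeasurableSpace (Ω n)] where
  /-- the set of admissible actions in a state -/
  adm : ∀ n, X n → Set (A n)
  /-- the system equation `x (n + 1) = F n (x n, a n, ξ n)`, on feasible state-action pairs -/
  F : ∀ n, {p : X n × A n // p.2 ∈ adm n p.1} × S n → X (n + 1)
  continuous_F : ∀ n, Continuous (F n)
  /-- the probability measure on `Ω n` -/
  P : ∀ n, Measure (Ω n)
  isProbabilityMeasure_P : ∀ n, IsProbabilityMeasure (P n)
  atomless_P : ∀ n, Atomless (P n)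
  /-- the noise variables -/
  ξ : ∀ n, Ω n → S n
  measurable_ξ : ∀ n, Measurable (ξ n)
  /-- the real nonnegative cost per stage, on feasible state-action pairs -/
  c : ∀ n, {p : X n × A n // p.2 ∈ adm n p.1} → ℝ≥0

namespace ControlModel

variable {X A S Ω : ℕ → Type*}
  [∀ n, TopologicalSpace (X n)] [∀ n, MeasurableSpace (X n)]
  [∀ n, TopologicalSpace (A n)] [∀ n, MeasurableSpace (A n)]
  [∀ n, TopologicalSpace (S n)] [∀ n, MeasurableSpace (S n)]
  [∀ n, MeasurableSpace (Ω n)]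

/-- The set of feasible state-action pairs at time `n`. -/
abbrev K (M : ControlModel X A S Ω) (n : ℕ) : Type _ :=
  {p : X n × A n // p.2 ∈ M.adm n p.1}

/-- The next state, as a function of the feasible pair and of the underlying random element. -/
def next (M : ControlModel X A S Ω) (n : ℕ) (k : M.K n) (ω : Ω n) : X (n + 1) :=
  M.F n (k, M.ξ n ω)

/-- The transition law: the law of the next state given a feasible pair. -/
def Q (M : ControlModel X A S Ω) (n : ℕ) (k : M.K n) : Measure (X (n + 1)) :=
  (M.P n).map (M.next n k)

/-- Weak continuity of the transition laws. -/
def WeaklyContinuous (M : ControlModel X A S Ω) : Prop :=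
  ∀ n, ∀ u : BoundedContinuousFunction (X (n + 1)) ℝ,
    Continuous fun k : M.K n => ∫ y, u y ∂(M.Q n k)

/-- A (deterministic Markov) policy: a sequence of measurable feasible decision rules. -/
structure Policy (M : ControlModel X A S Ω) where
  rule : ∀ n, X n → A n
  measurable_rule : ∀ n, Measurable (rule n)
  feasible : ∀ n x, rule n x ∈ M.adm n x

/-- The feasible pair that a policy chooses in a state. -/
def Policy.pair {M : ControlModel X A S Ω} (π : M.Policy) (n : ℕ) (x : X n) : M.K n :=
  ⟨(x, π.rule n x), π.feasible n x⟩

/-- The state process started at `x₀` under a policy. -/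
def state (M : ControlModel X A S Ω) (π : M.Policy) (x₀ : X 0) : (n : ℕ) → (∀ i, Ω i) → X n
  | 0, _ => x₀
  | n + 1, ω => M.next n (π.pair n (M.state π x₀ n ω)) (ω n)

/-- The expression `c n (x, a) + γ ρ n (v (x (n + 1)))`, for a `[0, ∞]`-valued function `v` on the
next state space. -/
def stepCost (M : ControlModel X A S Ω) (ρ : ∀ n, CondRiskMapping (M.K n) (M.P n)) (γ : ℝ≥0)
    (n : ℕ) (v : X (n + 1) → ℝ≥0∞) (k : M.K n) : ℝ≥0∞ :=
  (M.c n k : ℝ≥0∞) + γ * (ρ n).eval (fun k ω => v (M.next n k ω)) k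

/-- The finite horizon cost
`c n + γ ρ n (c (n + 1) + γ ρ (n + 1) (⋯ + γ ρ (n + m - 1) (c (n + m))))`
from the state `x` at time `n` under a policy. -/
def truncCost (M : ControlModel X A S Ω) (ρ : ∀ n, CondRiskMapping (M.K n) (M.P n)) (γ : ℝ≥0)
    (π : M.Policy) : (m n : ℕ) → X n → ℝ≥0∞
  | 0, n, x => M.c n (π.pair n x)
  | m + 1, n, x => M.stepCost ρ γ n (M.truncCost ρ γ π m (n + 1)) (π.pair n x)

/-- The infinite horizon cost of a policy from the state `x` at time `n`: the limit of the
nondecreasing finite horizon costs (`tendsto_truncCost`). -/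
def V (M : ControlModel X A S Ω) (ρ : ∀ n, CondRiskMapping (M.K n) (M.P n)) (γ : ℝ≥0)
    (π : M.Policy) (n : ℕ) (x : X n) : ℝ≥0∞ :=
  ⨆ m, M.truncCost ρ γ π m n x

lemma truncCost_le_succ (M : ControlModel X A S Ω) (ρ : ∀ n, CondRiskMapping (M.K n) (M.P n))
    (γ : ℝ≥0) (π : M.Policy) (m : ℕ) :
    ∀ n x, M.truncCost ρ γ π m n x ≤ M.truncCost ρ γ π (m + 1) n x := by
  induction m with
  | zero => intro n x; simp [truncCost, stepCost]
  | succ m ih =>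
    intro n x
    rw [truncCost, truncCost, stepCost, stepCost]
    gcongr
    exact (ρ n).eval_mono (Eventually.of_forall fun ω => ih _ _)

lemma tendsto_truncCost (M : ControlModel X A S Ω) (ρ : ∀ n, CondRiskMapping (M.K n) (M.P n))
    (γ : ℝ≥0) (π : M.Policy) (n : ℕ) (x : X n) :
    Tendsto (fun m => M.truncCost ρ γ π m n x) atTop (𝓝 (M.V ρ γ π n x)) :=
  tendsto_atTop_iSup (monotone_nat_of_le_succ fun m => M.truncCost_le_succ ρ γ π m n x)

/-- A policy is admissible (for the initial state `x₀`) if at every time the infinite horizon cost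
from the current state is almost surely finite. -/
def Admissible (M : ControlModel X A S Ω) (ρ : ∀ n, CondRiskMapping (M.K n) (M.P n)) (γ : ℝ≥0)
    (x₀ : X 0) (π : M.Policy) : Prop :=
  ∀ n, ∀ᵐ ω ∂(Measure.infinitePi M.P), M.V ρ γ π n (M.state π x₀ n ω) < ∞

/-- The optimal value functions: the infimum of the cost over all admissible policies. -/
def Vstar (M : ControlModel X A S Ω) (ρ : ∀ n, CondRiskMapping (M.K n) (M.P n)) (γ : ℝ≥0)
    (x₀ : X 0) (n : ℕ) (x : X n) : ℝ≥0∞ :=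
  ⨅ (π : M.Policy) (_ : M.Admissible ρ γ x₀ π), M.V ρ γ π n x

/-- The solutions of the optimality equations, among the sequences of measurable functions with
values in `[0, ∞]`. -/
def IsSolution (M : ControlModel X A S Ω) (ρ : ∀ n, CondRiskMapping (M.K n) (M.P n)) (γ : ℝ≥0)
    (v : ∀ n, X n → ℝ≥0∞) : Prop :=
  (∀ n, Measurable (v n)) ∧
    ∀ n x, v n x = ⨅ a : M.adm n x, M.stepCost ρ γ n (v (n + 1)) ⟨(x, a.1), a.2⟩

end ControlModel

end RobustControl

end

/-!
By law invariance, every `ρ n` applies a single finite coherent functional `R` on integrable random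
variables to all conditional laws, and its extension to `[0, ∞]`-valued variables is `upperExt`
(`eval_eq_upperExt`). A finite coherent functional is automatically continuous along sequences
that tend to zero in mean (`IsCoherent.exists_lt`), so that `upperExt` satisfies monotone
convergence and Fatou's lemma. As the system equation is continuous in the feasible pair, Fatou's
lemma makes `k ↦ c n k + γ * ρ n (v (x (n + 1)))` lower semicontinuous for every lower
semicontinuous `v` (`lowerSemicontinuous_stepCost`).

Let `valueIter` be value iteration from `0` and `valueLim` its increasing limit. Minimization over
compact, upper hemicontinuous action sets preserves lower semicontinuity, commutes with increasing
limits, and admits measurable minimizers. Hence `valueLim` is lower semicontinuous and solves the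
optimality equations, and some policy `π` attains all the minima. By induction on the horizon
`valueLim` lies below every solution and below the cost of every policy, while the cost of `π`
lies below `valueLim`.

It remains to see that `π` is admissible, for then `valueLim` is the infimum over the admissible
policies. It is finite at the initial state, and finiteness is inherited by the next state almost
surely: on an atomless space a law invariant coherent functional is positive on the indicator of
every non-null set (`IsCoherent.indicator_pos`), so a random variable with finite risk is almost
surely finite. The noises are independent, which carries this along the state process
(`ae_state_mem`).
-/

namespace RobustControl

/-! ### Coherent functionals on integrable random variables -/

section Coherent

variable {Ω : Type*} [MeasurableSpace Ω] {P : Measure Ω}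

/-- A finite coherent risk functional on the integrable random variables of `P`: monotone,
subadditive, positively homogeneous and normalized. Random variables are represented by
measurable functions, and the values of `R` on other functions are irrelevant. -/
structure IsCoherent (P : Measure Ω) (R : (Ω → ℝ) → ℝ) : Prop where
  mono : ∀ f g, Measurable f → Integrable f P → Measurable g → Integrable g P → f ≤ᵐ[P] g →
    R f ≤ R g
  add_le : ∀ f g, Measurable f → Integrable f P → Measurable g → Integrable g P →
    R (fun ω => f ω + g ω) ≤ R f + R g
  const_mul : ∀ f, Measurable f → Integrable f P → ∀ l : ℝ, 0 ≤ l →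
    R (fun ω => l * f ω) = l * R f
  one : R (fun _ => 1) = 1

/-- The extension of a functional to `[0, ∞]`-valued random variables by the supremum over the
integrable random variables below. -/
noncomputable def upperExt (P : Measure Ω) (R : (Ω → ℝ) → ℝ) (f : Ω → ℝ≥0∞) : ℝ≥0∞ :=
  ⨆ (Y : Ω → ℝ) (_ : Measurable Y ∧ Integrable Y P)
    (_ : ∀ᵐ ω ∂P, 0 ≤ Y ω ∧ ENNReal.ofReal (Y ω) ≤ f ω), ENNReal.ofReal (R Y)

lemma le_upperExt {R : (Ω → ℝ) → ℝ} {f : Ω → ℝ≥0∞} {Y : Ω → ℝ} (hY : Measurable Y)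
    (hYi : Integrable Y P) (h : ∀ᵐ ω ∂P, 0 ≤ Y ω ∧ ENNReal.ofReal (Y ω) ≤ f ω) :
    ENNReal.ofReal (R Y) ≤ upperExt P R f :=
  le_iSup_of_le Y (le_iSup_of_le ⟨hY, hYi⟩ (le_iSup_of_le h le_rfl))

lemma upperExt_mono {R : (Ω → ℝ) → ℝ} {f g : Ω → ℝ≥0∞} (h : ∀ ω, f ω ≤ g ω) :
    upperExt P R f ≤ upperExt P R g :=
  iSup_mono fun _ => iSup_mono fun _ => iSup_le fun h2 =>
    le_iSup_of_le (h2.mono fun ω h3 => ⟨h3.1, h3.2.trans (h ω)⟩) le_rfl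

namespace IsCoherent

variable {R : (Ω → ℝ) → ℝ}

/-- A finite coherent functional is continuous at `0` along nonnegative sequences. Otherwise all
`R (W j)` would be at least `ε`; for indices with `∫ W (j i) < 4⁻ⁱ` the sum of the
`2 ^ i * W (j i)` is integrable, and its risk is at least `2 ^ i * ε` for every `i`. -/
lemma exists_lt (hR : IsCoherent P R) {W : ℕ → Ω → ℝ} (hW : ∀ j, Measurable (W j))
    (hWi : ∀ j, Integrable (W j) P) (hW0 : ∀ j ω, 0 ≤ W j ω)
    (hlim : Tendsto (fun j => ∫ ω, W j ω ∂P) atTop (𝓝 0)) {ε : ℝ} (hε : 0 < ε) :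
    ∃ j, R (W j) < ε := by
  by_contra! hcon
  have hex : ∀ i : ℕ, ∃ j, ∫ ω, W j ω ∂P < (1 / 4 : ℝ) ^ i := fun i =>
    (hlim.eventually (gt_mem_nhds (by positivity))).exists
  choose j hj using hex
  let T : Ω → ℝ≥0∞ := fun ω => ∑' i, ENNReal.ofReal (2 ^ i * W (j i) ω)
  have hTm : Measurable T := by
    refine Measurable.tsum fun i => ?_
    exact ((hW (j i)).const_mul _).ennreal_ofReal
  have hTi : ∫⁻ ω, T ω ∂P ≠ ∞ := by
    have h1 : ∫⁻ ω, T ω ∂P ≤ ∑' i : ℕ, ENNReal.ofReal ((1 / 2 : ℝ) ^ i) := by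
      rw [lintegral_tsum fun i => ((hW (j i)).const_mul _).ennreal_ofReal.aemeasurable]
      refine ENNReal.tsum_le_tsum fun i => ?_
      rw [← ofReal_integral_eq_lintegral_ofReal ((hWi (j i)).const_mul _)
        (Eventually.of_forall fun ω => mul_nonneg (by positivity) (hW0 _ _)),
        integral_const_mul]
      refine ENNReal.ofReal_le_ofReal ?_
      calc (2 : ℝ) ^ i * ∫ ω, W (j i) ω ∂P ≤ 2 ^ i * (1 / 4) ^ i := by gcongr; exact (hj i).le
        _ = (1 / 2) ^ i := by rw [← mul_pow]; norm_num
    refine ne_top_of_le_ne_top ?_ h1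
    rw [← ENNReal.ofReal_tsum_of_nonneg (fun i => by positivity) summable_geometric_two]
    exact ENNReal.ofReal_ne_top
  have hTf : ∀ᵐ ω ∂P, T ω < ∞ := ae_lt_top hTm hTi
  have hle : ∀ i : ℕ, 2 ^ i * ε ≤ R (fun ω => (T ω).toReal) := fun i => by
    calc 2 ^ i * ε ≤ 2 ^ i * R (W (j i)) := by gcongr; exact hcon _
      _ = R (fun ω => 2 ^ i * W (j i) ω) :=
        (hR.const_mul _ (hW _) (hWi _) _ (by positivity)).symm
      _ ≤ R (fun ω => (T ω).toReal) := by
        refine hR.mono _ _ ((hW _).const_mul _) ((hWi _).const_mul _) hTm.ennreal_toReal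
          (integrable_toReal_of_lintegral_ne_top hTm.aemeasurable hTi) ?_
        filter_upwards [hTf] with ω hω
        exact (ENNReal.ofReal_le_iff_le_toReal hω.ne).1
          (ENNReal.le_tsum (f := fun i => ENNReal.ofReal (2 ^ i * W (j i) ω)) i)
  obtain ⟨i, hi⟩ := pow_unbounded_of_one_lt (R (fun ω => (T ω).toReal) / ε) one_lt_two
  rw [div_lt_iff₀ hε] at hi
  exact absurd (hle i) (not_le.2 hi)

/-- Monotone convergence. -/
lemma upperExt_iSup_le (hR : IsCoherent P R) {f : ℕ → Ω → ℝ≥0∞} (hf : ∀ j, Measurable (f j))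
    (hmono : Monotone f) :
    upperExt P R (fun ω => ⨆ j, f j ω) ≤ ⨆ j, upperExt P R (f j) := by
  refine iSup_le fun Y => iSup_le fun hY => iSup_le fun hle => ?_
  -- `Y` is split into the part below `f j` and the remainder, whose risk is small for some `j`.
  let U : ℕ → Ω → ℝ := fun j ω => (min (ENNReal.ofReal (Y ω)) (f j ω)).toReal
  let W : ℕ → Ω → ℝ := fun j ω => (ENNReal.ofReal (Y ω) - f j ω).toReal
  have hUm : ∀ j, Measurable (U j) := fun j =>
    (hY.1.ennreal_ofReal.min (hf j)).ennreal_toReal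
  have hWm : ∀ j, Measurable (W j) := fun j =>
    (hY.1.ennreal_ofReal.sub (hf j)).ennreal_toReal
  have hbound : ∀ (z : ℝ≥0∞) ω, z ≤ ENNReal.ofReal (Y ω) → ‖z.toReal‖ ≤ ‖Y ω‖ := by
    intro z ω hz
    rw [Real.norm_of_nonneg ENNReal.toReal_nonneg]
    refine ENNReal.toReal_le_of_le_ofReal (norm_nonneg _) (hz.trans ?_)
    exact ENNReal.ofReal_le_ofReal (Real.le_norm_self _)
  have hUi : ∀ j, Integrable (U j) P := fun j => hY.2.mono (hUm j).aestronglyMeasurable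
    (Eventually.of_forall fun ω => hbound _ ω (min_le_left _ _))
  have hWi : ∀ j, Integrable (W j) P := fun j => hY.2.mono (hWm j).aestronglyMeasurable
    (Eventually.of_forall fun ω => hbound _ ω tsub_le_self)
  have hlim : Tendsto (fun j => ∫ ω, W j ω ∂P) atTop (𝓝 0) := by
    have := tendsto_integral_of_dominated_convergence (F := W) (f := fun _ => 0)
      (fun ω => ‖Y ω‖) (fun j => (hWm j).aestronglyMeasurable) hY.2.norm
      (fun j => Eventually.of_forall fun ω => hbound _ ω tsub_le_self) (by
        filter_upwards [hle] with ω hω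
        have h1 : Tendsto (fun j => f j ω) atTop (𝓝 (⨆ j, f j ω)) :=
          tendsto_atTop_iSup fun a b hab => hmono hab ω
        have h2 : Tendsto (fun j => ENNReal.ofReal (Y ω) - f j ω) atTop (𝓝 0) := by
          have := ENNReal.Tendsto.sub (tendsto_const_nhds (x := ENNReal.ofReal (Y ω))) h1
            (Or.inl ENNReal.ofReal_ne_top)
          rwa [tsub_eq_zero_of_le hω.2] at this
        exact (ENNReal.tendsto_toReal ENNReal.zero_ne_top).comp h2)
    simpa using this
  refine ENNReal.le_of_forall_pos_le_add fun ε hε _ => ?_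
  obtain ⟨j, hj⟩ := hR.exists_lt hWm hWi (fun _ _ => ENNReal.toReal_nonneg) hlim
    (NNReal.coe_pos.2 hε)
  have h1 : R Y ≤ R (U j) + ε := by
    calc R Y ≤ R (fun ω => U j ω + W j ω) := by
          refine hR.mono _ _ hY.1 hY.2 ((hUm j).add (hWm j)) ((hUi j).add (hWi j)) ?_
          filter_upwards [hle] with ω hω
          have hfin : min (ENNReal.ofReal (Y ω)) (f j ω) ≠ ∞ :=
            ne_top_of_le_ne_top ENNReal.ofReal_ne_top (min_le_left _ _)
          have hfin' : ENNReal.ofReal (Y ω) - f j ω ≠ ∞ :=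
            ne_top_of_le_ne_top ENNReal.ofReal_ne_top tsub_le_self
          simp only [U, W]
          rw [← ENNReal.toReal_add hfin hfin',
            ← ENNReal.ofReal_le_iff_le_toReal (ENNReal.add_ne_top.2 ⟨hfin, hfin'⟩)]
          rcases le_total (ENNReal.ofReal (Y ω)) (f j ω) with h | h
          · simp [h]
          · rw [min_eq_right h, add_tsub_cancel_of_le h]
      _ ≤ R (U j) + R (W j) := hR.add_le _ _ (hUm j) (hUi j) (hWm j) (hWi j)
      _ ≤ R (U j) + ε := by gcongr
  calc ENNReal.ofReal (R Y) ≤ ENNReal.ofReal (R (U j) + ε) := ENNReal.ofReal_le_ofReal h1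
    _ ≤ ENNReal.ofReal (R (U j)) + ENNReal.ofReal ε := ENNReal.ofReal_add_le
    _ ≤ (⨆ j, upperExt P R (f j)) + ε := by
      rw [ENNReal.ofReal_coe_nnreal]
      gcongr
      refine le_iSup_of_le j (le_upperExt (hUm j) (hUi j) (Eventually.of_forall fun ω =>
        ⟨ENNReal.toReal_nonneg, ?_⟩))
      exact ENNReal.ofReal_toReal_le.trans (min_le_right _ _)

/-- Fatou's lemma. -/
lemma upperExt_le_of_le_liminf (hR : IsCoherent P R) {f : ℕ → Ω → ℝ≥0∞}
    (hf : ∀ j, Measurable (f j)) {g : Ω → ℝ≥0∞}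
    (hg : ∀ ω, g ω ≤ liminf (fun j => f j ω) atTop) {t : ℝ≥0∞}
    (ht : ∀ j, upperExt P R (f j) ≤ t) : upperExt P R g ≤ t := by
  let G : ℕ → Ω → ℝ≥0∞ := fun i ω => ⨅ j, f (i + j) ω
  have hG : ∀ i, Measurable (G i) := fun i => Measurable.iInf fun j => hf _
  have hGm : Monotone G := monotone_nat_of_le_succ fun i ω => by
    refine le_iInf fun j => (iInf_le _ (j + 1)).trans (le_of_eq ?_)
    congr 1; ring
  calc upperExt P R g ≤ upperExt P R (fun ω => ⨆ i, G i ω) := by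
        refine upperExt_mono fun ω => (hg ω).trans (le_of_eq ?_)
        rw [liminf_eq_iSup_iInf_of_nat']
        simp only [G, add_comm]
    _ ≤ ⨆ i, upperExt P R (G i) := hR.upperExt_iSup_le hG hGm
    _ ≤ t := iSup_le fun i => (upperExt_mono fun ω => iInf_le _ 0).trans (ht (i + 0))

end IsCoherent

end Coherent

/-! ### The functional of a law invariant conditional risk mapping -/

section Risk

variable {H Ω : Type*} [MeasurableSpace H] [MeasurableSpace Ω] {P : Measure Ω}

namespace CondRiskMapping

/-- The values of a conditional risk mapping at `h` on the random variables that do not depend on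
the present information. For a law invariant mapping this does not depend on `h` and determines
the mapping (`eval_eq_upperExt`). -/
noncomputable def slice (ρ : CondRiskMapping H P) (h : H) (f : Ω → ℝ) : ℝ := ρ.toFun (fun _ => f) h

lemma const_mem_nextL1 {f : Ω → ℝ} (hf : Measurable f) (hfi : Integrable f P) :
    (fun _ : H => f) ∈ NextL1 H P :=
  ⟨hf.comp measurable_snd, fun _ => hfi⟩

lemma isCoherent_slice [IsProbabilityMeasure P] (ρ : CondRiskMapping H P) (h : H) :
    IsCoherent P (ρ.slice h) where
  mono f g hf hfi hg hgi hfg :=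
    ρ.mono _ (const_mem_nextL1 hf hfi) _ (const_mem_nextL1 hg hgi) (fun _ => hfg) h
  add_le f g hf hfi hg hgi := by
    -- Subadditivity is convexity at the midpoint of `2 f` and `2 g`.
    have h1 := ρ.convex _ (const_mem_nextL1 (hf.const_mul 2) (hfi.const_mul 2)) _
      (const_mem_nextL1 (hg.const_mul 2) (hgi.const_mul 2)) (1 / 2) (by norm_num) (by norm_num) h
    rw [ρ.homogeneous _ (const_mem_nextL1 hf hfi) (fun _ => 2) measurable_const (by norm_num),
      ρ.homogeneous _ (const_mem_nextL1 hg hgi) (fun _ => 2) measurable_const (by norm_num)] at h1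
    have h2 : (fun (_ : H) ω => (1 / 2 : ℝ) * (2 * f ω) + (1 - 1 / 2) * (2 * g ω)) =
        fun _ ω => f ω + g ω := by
      funext _ ω; ring
    rw [h2] at h1
    refine h1.trans (le_of_eq ?_)
    simp only [slice]; ring
  const_mul f hf hfi l hl :=
    ρ.homogeneous _ (const_mem_nextL1 hf hfi) (fun _ => l) measurable_const (fun _ => hl) h
  one := by
    have h0 : ρ.toFun (fun _ _ => 0) h = 0 := by
      simpa using ρ.homogeneous (fun _ _ => 0) (const_mem_nextL1 measurable_const
        (integrable_zero _ _ _)) (fun _ => 0) measurable_const (fun _ => le_rfl) h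
    simpa [slice, h0] using ρ.translation (fun _ _ => 0) (const_mem_nextL1 measurable_const
      (integrable_zero _ _ _)) (fun _ => 1) measurable_const h

lemma LawInvariant.slice_eq {ρ : CondRiskMapping H P} (hρ : ρ.LawInvariant) (h : H)
    {f g : Ω → ℝ} (hf : Measurable f) (hfi : Integrable f P) (hg : Measurable g)
    (hgi : Integrable g P) (hfg : P.map f = P.map g) : ρ.slice h f = ρ.slice h g :=
  hρ _ (const_mem_nextL1 hf hfi) _ (const_mem_nextL1 hg hgi) h h hfg

/-- A law invariant conditional risk mapping applies one and the same functional to all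
conditional laws. -/
lemma LawInvariant.eval_eq_upperExt {ρ : CondRiskMapping H P} (hρ : ρ.LawInvariant) (h₀ : H)
    (Z : H → Ω → ℝ≥0∞) (h : H) : ρ.eval Z h = upperExt P (ρ.slice h₀) (Z h) := by
  apply le_antisymm
  · refine iSup_le fun Y => iSup_le fun hY => iSup_le fun hle => ?_
    have hm : Measurable (Y h) := hY.1.comp measurable_prodMk_left
    rw [hρ Y hY _ (const_mem_nextL1 hm (hY.2 h)) h h₀ rfl]
    exact le_upperExt hm (hY.2 h) hle
  · refine iSup_le fun Y => iSup_le fun hY => iSup_le fun hle => ?_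
    have hY' := const_mem_nextL1 (H := H) hY.1 hY.2
    rw [slice, hρ _ hY' _ hY' h₀ h rfl]
    exact le_iSup_of_le (fun _ => Y) (le_iSup_of_le hY' (le_iSup_of_le hle le_rfl))

end CondRiskMapping

end Risk

/-! ### Atomless measures -/

section Atomless

variable {Ω : Type*} [MeasurableSpace Ω] {P : Measure Ω} [IsFiniteMeasure P]

lemma Atomless.exists_half (hP : Atomless P) {E : Set Ω} (hE : MeasurableSet E)
    (h0 : 0 < P.real E) :
    ∃ t ⊆ E, MeasurableSet t ∧ 0 < P.real t ∧ 2 * P.real t ≤ P.real E := by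
  have hE0 : 0 < P E := pos_iff_ne_zero.2 fun h => by simp [measureReal_def, h] at h0
  obtain ⟨t, htE, ht, ht0, htlt⟩ := hP E hE hE0
  have h1 : 0 < P.real t := ENNReal.toReal_pos ht0.ne' (measure_ne_top _ _)
  have h2 : P.real t < P.real E := (ENNReal.toReal_lt_toReal (measure_ne_top _ _)
    (measure_ne_top _ _)).2 htlt
  have h3 : P.real (E \ t) = P.real E - P.real t := measureReal_sdiff htE ht
  rcases le_total (2 * P.real t) (P.real E) with h | h
  · exact ⟨t, htE, ht, h1, h⟩
  · exact ⟨E \ t, Set.sdiff_subset, hE.diff ht, by linarith, by linarith⟩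

lemma Atomless.exists_small (hP : Atomless P) {E : Set Ω} (hE : MeasurableSet E)
    (h0 : 0 < P.real E) {ε : ℝ} (hε : 0 < ε) :
    ∃ t ⊆ E, MeasurableSet t ∧ 0 < P.real t ∧ P.real t ≤ ε := by
  have h : ∀ i : ℕ, ∃ t ⊆ E, MeasurableSet t ∧ 0 < P.real t ∧ 2 ^ i * P.real t ≤ P.real E := by
    intro i
    induction i with
    | zero => exact ⟨E, subset_rfl, hE, h0, by simp⟩
    | succ i ih =>
      obtain ⟨t, htE, ht, ht0, hti⟩ := ih
      obtain ⟨s, hst, hs, hs0, hsi⟩ := hP.exists_half ht ht0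
      refine ⟨s, hst.trans htE, hs, hs0, ?_⟩
      calc (2 : ℝ) ^ (i + 1) * P.real s = 2 ^ i * (2 * P.real s) := by ring
        _ ≤ 2 ^ i * P.real t := by gcongr
        _ ≤ P.real E := hti
  obtain ⟨i, hi⟩ := pow_unbounded_of_one_lt (P.real E / ε) one_lt_two
  obtain ⟨t, htE, ht, ht0, hti⟩ := h i
  refine ⟨t, htE, ht, ht0, ?_⟩
  rw [div_lt_iff₀ hε] at hi
  exact le_of_mul_le_mul_left (hti.trans hi.le) (by positivity)

/-- **Sierpiński's theorem**: an atomless finite measure takes all intermediate values. The set is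
the union of an increasing sequence, each step of which gains at least half of what is possible
without exceeding `c`. -/
lemma Atomless.exists_measureReal_eq (hP : Atomless P) {E : Set Ω} (hE : MeasurableSet E) {c : ℝ}
    (hc0 : 0 ≤ c) (hcE : c ≤ P.real E) : ∃ t ⊆ E, MeasurableSet t ∧ P.real t = c := by
  let T : Set (Set Ω) := {A | A ⊆ E ∧ MeasurableSet A ∧ P.real A ≤ c}
  have hstep : ∀ A : T, ∃ A' : T, A.1 ⊆ A'.1 ∧
      ∀ B ∈ T, A.1 ⊆ B → P.real B + P.real A.1 ≤ 2 * P.real A'.1 := by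
    intro A
    let V : Set ℝ := P.real '' {B | B ∈ T ∧ A.1 ⊆ B}
    have hV : BddAbove V := ⟨c, by rintro _ ⟨B, hB, rfl⟩; exact hB.1.2.2⟩
    have hAV : P.real A.1 ∈ V := ⟨A.1, ⟨A.2, subset_rfl⟩, rfl⟩
    rcases (le_csSup hV hAV).eq_or_lt with h | h
    · refine ⟨A, subset_rfl, fun B hB hAB => ?_⟩
      have := le_csSup hV ⟨B, ⟨hB, hAB⟩, rfl⟩
      linarith
    · obtain ⟨_, ⟨A', hA', rfl⟩, hlt⟩ := exists_lt_of_lt_csSup ⟨_, hAV⟩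
        (show (P.real A.1 + sSup V) / 2 < sSup V by linarith)
      refine ⟨⟨A', hA'.1⟩, hA'.2, fun B hB hAB => ?_⟩
      have := le_csSup hV ⟨B, ⟨hB, hAB⟩, rfl⟩
      simp only
      linarith
  choose next hsub hnext using hstep
  let a : ℕ → T := fun k => next^[k] ⟨∅, Set.empty_subset _, MeasurableSet.empty, by simpa⟩
  have ha : ∀ k, a (k + 1) = next (a k) := fun k => Function.iterate_succ_apply' _ _ _
  have hmono : Monotone fun k => (a k).1 := monotone_nat_of_le_succ fun k => by
    simp only [ha]; exact hsub _
  let U : Set Ω := ⋃ k, (a k).1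
  have hU : MeasurableSet U := MeasurableSet.iUnion fun k => (a k).2.2.1
  have hUE : U ⊆ E := Set.iUnion_subset fun k => (a k).2.1
  have hlim : Tendsto (fun k => P.real (a k).1) atTop (𝓝 (P.real U)) :=
    (ENNReal.tendsto_toReal (measure_ne_top _ _)).comp (tendsto_measure_iUnion_atTop hmono)
  have hUc : P.real U ≤ c := le_of_tendsto' hlim fun k => (a k).2.2.2
  refine ⟨U, hUE, hU, hUc.antisymm (not_lt.1 fun hlt => ?_)⟩
  have hd : P.real (E \ U) = P.real E - P.real U := measureReal_sdiff hUE hU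
  obtain ⟨C, hCE, hC, hC0, hCle⟩ := hP.exists_small (hE.diff hU)
    (show 0 < P.real (E \ U) by linarith) (sub_pos.2 hlt)
  have hUC : P.real (U ∪ C) = P.real U + P.real C :=
    measureReal_union (Set.disjoint_left.2 fun x hx hx' => (hCE hx').2 hx) hC
  have hT : U ∪ C ∈ T := ⟨Set.union_subset hUE (hCE.trans Set.sdiff_subset), hU.union hC, by
    linarith⟩
  have hineq : ∀ k, P.real (U ∪ C) + P.real (a k).1 ≤ 2 * P.real (a (k + 1)).1 := fun k => by
    rw [ha]
    exact hnext _ _ hT ((Set.subset_iUnion (fun k => (a k).1) k).trans Set.subset_union_left)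
  have := le_of_tendsto_of_tendsto' (hlim.const_add (P.real (U ∪ C)))
    ((hlim.comp (tendsto_add_atTop_nat 1)).const_mul 2) hineq
  linarith

end Atomless

/-! ### Null sets and infinite values -/

section Positivity

variable {Ω : Type*} [MeasurableSpace Ω] {P : Measure Ω} [IsProbabilityMeasure P]

lemma map_indicator_one_eq {B C : Set Ω} (hB : MeasurableSet B) (hC : MeasurableSet C)
    (h : P.real B = P.real C) :
    P.map (B.indicator fun _ => (1 : ℝ)) = P.map (C.indicator fun _ => (1 : ℝ)) := by
  have h' : P B = P C := (measureReal_eq_measureReal_iff).1 h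
  ext s hs
  rw [Measure.map_apply (measurable_const.indicator hB) hs,
    Measure.map_apply (measurable_const.indicator hC) hs]
  have hc : P Bᶜ = P Cᶜ := by rw [prob_compl_eq_one_sub hB, prob_compl_eq_one_sub hC, h']
  classical
  rw [Set.indicator_const_preimage_eq_union, Set.indicator_const_preimage_eq_union]
  by_cases h1 : (1 : ℝ) ∈ s <;> by_cases h0 : (0 : ℝ) ∈ s <;> simp [h1, h0, h', hc]

/-- On an atomless space a law invariant coherent functional charges every non-null set: a set of
probability `1 / n` has `n` disjoint copies that cover the space, so its indicator has risk at
least `1 / n`. -/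
lemma IsCoherent.indicator_pos {R : (Ω → ℝ) → ℝ} (hR : IsCoherent P R) (hP : Atomless P)
    (hlaw : ∀ f g, Measurable f → Integrable f P → Measurable g → Integrable g P →
      P.map f = P.map g → R f = R g)
    {B : Set Ω} (hB : MeasurableSet B) (hB0 : P B ≠ 0) : 0 < R (B.indicator fun _ => 1) := by
  have hm : ∀ {C : Set Ω}, MeasurableSet C → Measurable (C.indicator fun _ => (1 : ℝ)) :=
    fun hC => measurable_const.indicator hC
  have hi : ∀ {C : Set Ω}, MeasurableSet C → Integrable (C.indicator fun _ => (1 : ℝ)) P :=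
    fun hC => (integrable_const _).indicator hC
  have hBpos : 0 < P.real B := ENNReal.toReal_pos hB0 (measure_ne_top _ _)
  obtain ⟨n, hn⟩ := exists_nat_one_div_lt hBpos
  have hn0 : (0 : ℝ) < 1 / (n + 1) := by positivity
  obtain ⟨D, hDB, hD, hDn⟩ := hP.exists_measureReal_eq hB hn0.le hn.le
  have hcover : ∀ m : ℕ, ∀ E : Set Ω, MeasurableSet E → P.real E = m * (1 / (n + 1)) →
      R (E.indicator fun _ => 1) ≤ m * R (D.indicator fun _ => 1) := by
    intro m
    induction m with
    | zero =>
      intro E hE hE0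
      have hE0' : P E = 0 := by simpa [measureReal_eq_zero_iff] using hE0
      have h0 := hR.const_mul _ (hm hD) (hi hD) 0 le_rfl
      rw [Nat.cast_zero, ← h0]
      refine hR.mono _ _ (hm hE) (hi hE) ((hm hD).const_mul _) ((hi hD).const_mul _) ?_
      filter_upwards [measure_eq_zero_iff_ae_notMem.1 hE0'] with ω hω
      simp [hω]
    | succ m ih =>
      intro E hE hEm
      push_cast at hEm
      have hm0 : (0 : ℝ) ≤ m * (1 / (n + 1)) := by positivity
      obtain ⟨t, htE, ht, htn⟩ := hP.exists_measureReal_eq hE hn0.le (by linarith)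
      have hdiff : P.real (E \ t) = m * (1 / (n + 1)) := by
        rw [measureReal_sdiff htE ht, hEm, htn]; ring
      have hsplit : (E.indicator fun _ => (1 : ℝ)) =
          fun ω => t.indicator (fun _ => 1) ω + (E \ t).indicator (fun _ => 1) ω := by
        funext ω
        by_cases h1 : ω ∈ t
        · simp [h1, htE h1]
        · by_cases h2 : ω ∈ E <;> simp [h1, h2]
      calc R (E.indicator fun _ => 1) ≤ R (t.indicator fun _ => 1) +
            R ((E \ t).indicator fun _ => 1) := by
            rw [hsplit]; exact hR.add_le _ _ (hm ht) (hi ht) (hm (hE.diff ht)) (hi (hE.diff ht))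
        _ ≤ R (D.indicator fun _ => 1) + m * R (D.indicator fun _ => 1) := by
            refine add_le_add (le_of_eq ?_) (ih _ (hE.diff ht) hdiff)
            exact hlaw _ _ (hm ht) (hi ht) (hm hD) (hi hD)
              (map_indicator_one_eq ht hD (htn.trans hDn.symm))
        _ = (m + 1 : ℕ) * R (D.indicator fun _ => 1) := by push_cast; ring
  have hone := hcover (n + 1) Set.univ MeasurableSet.univ (by
    rw [probReal_univ]; push_cast; field_simp)
  rw [Set.indicator_univ, hR.one] at hone
  have hDpos : 0 < R (D.indicator fun _ => 1) :=
    pos_of_mul_pos_right (lt_of_lt_of_le one_pos hone) (Nat.cast_nonneg _)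
  refine hDpos.trans_le (hR.mono _ _ (hm hD) (hi hD) (hm hB) (hi hB) ?_)
  exact Eventually.of_forall fun ω =>
    Set.indicator_le_indicator_of_subset hDB (fun _ => zero_le_one) ω

/-- If `f` were infinite on a non-null set `B`, then all multiples of the indicator of `B`, whose
risks are unbounded, would lie below `f`. -/
lemma IsCoherent.ae_lt_top_of_upperExt_lt_top {R : (Ω → ℝ) → ℝ} (hR : IsCoherent P R)
    (hP : Atomless P)
    (hlaw : ∀ f g, Measurable f → Integrable f P → Measurable g → Integrable g P →
      P.map f = P.map g → R f = R g)
    {f : Ω → ℝ≥0∞} (hf : Measurable f) (hfin : upperExt P R f < ∞) : ∀ᵐ ω ∂P, f ω < ∞ := by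
  by_contra hcon
  let B : Set Ω := {ω | f ω = ∞}
  have hB : MeasurableSet B := hf (measurableSet_singleton ∞)
  have hB0 : P B ≠ 0 := by
    rw [ae_iff] at hcon
    simpa [B] using hcon
  have hpos := hR.indicator_pos hP hlaw hB hB0
  have hm : Measurable (B.indicator fun _ => (1 : ℝ)) := measurable_const.indicator hB
  have hi : Integrable (B.indicator fun _ => (1 : ℝ)) P := (integrable_const _).indicator hB
  have hle : ∀ m : ℕ, m * R (B.indicator fun _ => 1) ≤ (upperExt P R f).toReal := fun m => by
    rw [← hR.const_mul _ hm hi m (Nat.cast_nonneg _), ← ENNReal.ofReal_le_iff_le_toReal hfin.ne]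
    refine le_upperExt (hm.const_mul _) (hi.const_mul _) (Eventually.of_forall fun ω => ?_)
    by_cases hω : ω ∈ B
    · simp [hω, show f ω = ∞ from hω]
    · simp [hω]
  obtain ⟨m, hmlt⟩ := exists_nat_gt ((upperExt P R f).toReal / R (B.indicator fun _ => 1))
  rw [div_lt_iff₀ hpos] at hmlt
  exact absurd (hle m) (not_le.2 hmlt)

end Positivity

/-! ### Measurable selections -/

section Selection

variable {X A : Type*} [MeasurableSpace X] [MetricSpace A]

/-- Compact-valued correspondences that hit closed sets measurably can be shrunk, with the same
properties, to values of small diameter: intersect with the first ball, from a countable cover,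
that meets the value. -/
lemma exists_small_subcorrespondence [TopologicalSpace.SeparableSpace A] [Nonempty A]
    {D : X → Set A} (hD : ∀ x, IsCompact (D x)) (hne : ∀ x, (D x).Nonempty)
    (hm : ∀ C, IsClosed C → MeasurableSet {x | (D x ∩ C).Nonempty}) {ε : ℝ} (hε : 0 < ε) :
    ∃ D' : X → Set A, (∀ x, D' x ⊆ D x) ∧ (∀ x, IsCompact (D' x)) ∧ (∀ x, (D' x).Nonempty) ∧
      (∀ C, IsClosed C → MeasurableSet {x | (D' x ∩ C).Nonempty}) ∧
      ∀ x, ∀ y ∈ D' x, ∀ z ∈ D' x, dist y z ≤ 2 * ε := by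
  classical
  let B : ℕ → Set A := fun i => Metric.closedBall (TopologicalSpace.denseSeq A i) ε
  have hex : ∀ x, ∃ i, (D x ∩ B i).Nonempty := fun x => by
    obtain ⟨y, hy⟩ := hne x
    obtain ⟨i, hi⟩ := (TopologicalSpace.denseRange_denseSeq A).exists_dist_lt y hε
    exact ⟨i, y, hy, hi.le⟩
  let i : X → ℕ := fun x => Nat.find (hex x)
  have hi : Measurable i := measurable_find hex fun k => hm _ Metric.isClosed_closedBall
  refine ⟨fun x => D x ∩ B (i x), fun x => Set.inter_subset_left,
    fun x => (hD x).inter_right Metric.isClosed_closedBall, fun x => Nat.find_spec (hex x), ?_, ?_⟩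
  · intro C hC
    have : {x | (D x ∩ B (i x) ∩ C).Nonempty} =
        ⋃ j, i ⁻¹' {j} ∩ {x | (D x ∩ (B j ∩ C)).Nonempty} := by
      ext x
      simp [Set.inter_assoc]
    rw [this]
    exact MeasurableSet.iUnion fun j => (hi (measurableSet_singleton j)).inter
      (hm _ (Metric.isClosed_closedBall.inter hC))
  · intro x y hy z hz
    calc dist y z ≤ dist y _ + dist z _ := dist_triangle_right _ _ _
      _ ≤ ε + ε := add_le_add hy.2 hz.2
      _ = 2 * ε := by ring

/-- A measurable selection theorem of Kuratowski and Ryll-Nardzewski type, for nonempty compact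
values. -/
theorem exists_measurable_selection [TopologicalSpace.SeparableSpace A] [MeasurableSpace A]
    [BorelSpace A] {D : X → Set A} (hD : ∀ x, IsCompact (D x)) (hne : ∀ x, (D x).Nonempty)
    (hm : ∀ C, IsClosed C → MeasurableSet {x | (D x ∩ C).Nonempty}) :
    ∃ s : X → A, Measurable s ∧ ∀ x, s x ∈ D x := by
  rcases isEmpty_or_nonempty X with hX | ⟨⟨x₀⟩⟩
  · exact ⟨fun x => (hne x).some, measurable_of_empty _, fun x => (hne x).some_mem⟩
  have : Nonempty A := (hne x₀).to_type
  let T : Set (X → Set A) := {D | (∀ x, IsCompact (D x)) ∧ (∀ x, (D x).Nonempty) ∧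
    ∀ C, IsClosed C → MeasurableSet {x | (D x ∩ C).Nonempty}}
  have hstep : ∀ (n : ℕ) (E : T), ∃ E' : T, (∀ x, E'.1 x ⊆ E.1 x) ∧
      ∀ x, ∀ y ∈ E'.1 x, ∀ z ∈ E'.1 x, dist y z ≤ 2 * (1 / (n + 1)) := fun n E => by
    obtain ⟨E', h1, h2, h3, h4, h5⟩ := exists_small_subcorrespondence E.2.1 E.2.2.1 E.2.2.2
      (ε := 1 / (n + 1)) (by positivity)
    exact ⟨⟨E', h2, h3, h4⟩, h1, h5⟩
  choose next hsub hdist using hstep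
  let E : ℕ → T := fun n => Nat.rec ⟨D, hD, hne, hm⟩ (fun n E => next n E) n
  have hE : ∀ n x, (E (n + 1)).1 x ⊆ (E n).1 x := fun n x => hsub n (E n) x
  have hinter : ∀ x, (⋂ n, (E n).1 x).Nonempty := fun x =>
    IsCompact.nonempty_iInter_of_sequence_nonempty_isCompact_isClosed _ (fun n => hE n x)
      (fun n => (E n).2.2.1 x) ((E 0).2.1 x) fun n => ((E n).2.1 x).isClosed
  choose s hs using hinter
  have hs' : ∀ x n, s x ∈ (E n).1 x := fun x => Set.mem_iInter.1 (hs x)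
  refine ⟨s, measurable_of_isClosed fun C hC => ?_, fun x => hs' x 0⟩
  have : s ⁻¹' C = ⋂ n, {x | ((E n).1 x ∩ C).Nonempty} := by
    ext x
    refine ⟨fun hx => Set.mem_iInter.2 fun n => ⟨s x, hs' x n, hx⟩, fun hx => ?_⟩
    obtain ⟨y, hy⟩ := IsCompact.nonempty_iInter_of_sequence_nonempty_isCompact_isClosed
      (fun n => (E n).1 x ∩ C) (fun n => Set.inter_subset_inter_left _ (hE n x))
      (fun n => Set.mem_iInter.1 hx n) (((E 0).2.1 x).inter_right hC)
      fun n => ((E n).2.1 x).isClosed.inter hC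
    have hy' := Set.mem_iInter.1 hy
    have hlim : Tendsto (fun n : ℕ => 2 * (1 / ((n : ℝ) + 1))) atTop (𝓝 0) := by
      simpa using (tendsto_one_div_add_atTop_nhds_zero_nat (𝕜 := ℝ)).const_mul 2
    have hd : dist (s x) y ≤ 0 := ge_of_tendsto' hlim fun n =>
      hdist n (E n) x _ (hs' x (n + 1)) _ (hy' (n + 1)).1
    rw [Set.mem_preimage, dist_le_zero.1 hd]
    exact (hy' 0).2
  rw [this]
  exact MeasurableSet.iInter fun n => (E n).2.2.2 C hC

end Selection

/-! ### Minimization over upper hemicontinuous compact-valued correspondences -/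

section Minimization

variable {X A : Type*} {Γ : X → Set A}

/-- The infimum over the admissible actions in a state of a function on the graph of the
correspondence `Γ`. -/
noncomputable def fiberInf (Γ : X → Set A) (f : {p : X × A // p.2 ∈ Γ p.1} → ℝ≥0∞) (x : X) :
    ℝ≥0∞ :=
  ⨅ a : Γ x, f ⟨(x, a.1), a.2⟩

lemma fiberInf_mono {f g : {p : X × A // p.2 ∈ Γ p.1} → ℝ≥0∞} (h : ∀ k, f k ≤ g k) (x : X) :
    fiberInf Γ f x ≤ fiberInf Γ g x :=
  iInf_mono fun _ => h _

lemma fiberInf_le (f : {p : X × A // p.2 ∈ Γ p.1} → ℝ≥0∞) (k : {p : X × A // p.2 ∈ Γ p.1}) :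
    fiberInf Γ f k.1.1 ≤ f k :=
  iInf_le (fun a : Γ k.1.1 => f ⟨(k.1.1, a.1), a.2⟩) ⟨k.1.2, k.2⟩

variable [TopologicalSpace X] [TopologicalSpace A]

lemma continuous_fiber (x : X) :
    Continuous fun a : Γ x => (⟨(x, a.1), a.2⟩ : {p : X × A // p.2 ∈ Γ p.1}) :=
  (continuous_const.prodMk continuous_subtype_val).subtype_mk _

lemma lowerSemicontinuous_fiber {f : {p : X × A // p.2 ∈ Γ p.1} → ℝ≥0∞}
    (hf : LowerSemicontinuous f) (x : X) :
    LowerSemicontinuous fun a : Γ x => f ⟨(x, a.1), a.2⟩ :=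
  hf.comp (continuous_fiber x)

lemma exists_eq_fiberInf (hc : ∀ x, IsCompact (Γ x))
    {f : {p : X × A // p.2 ∈ Γ p.1} → ℝ≥0∞} (hf : LowerSemicontinuous f) {x : X}
    (hne : (Γ x).Nonempty) : ∃ a : Γ x, f ⟨(x, a.1), a.2⟩ = fiberInf Γ f x := by
  have := isCompact_iff_compactSpace.1 (hc x)
  have := hne.to_subtype
  obtain ⟨a, -, ha⟩ := LowerSemicontinuousOn.exists_isMinOn Set.univ_nonempty isCompact_univ
    ((lowerSemicontinuous_fiber hf x).lowerSemicontinuousOn Set.univ)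
  exact ⟨a, le_antisymm (le_iInf fun b => isMinOn_iff.1 ha b (Set.mem_univ _)) (iInf_le _ a)⟩

/-- The projection of the graph to the state space is a closed map. -/
lemma isClosed_image_graph (hΓ : UpperHemicontinuous Γ) (hc : ∀ x, IsCompact (Γ x))
    {C : Set {p : X × A // p.2 ∈ Γ p.1}} (hC : IsClosed C) :
    IsClosed ((fun k => k.1.1) '' C) := by
  obtain ⟨C', hC', rfl⟩ := isClosed_induced_iff.1 hC
  rw [← isOpen_compl_iff, isOpen_iff_mem_nhds]
  intro x hx
  obtain ⟨U, W, hU, hW, hxU, hΓW, hUW⟩ := generalized_tube_lemma (isCompact_singleton (x := x))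
    (hc x) hC'.isOpen_compl (by
      rintro ⟨y, a⟩ ⟨rfl : y = x, ha⟩ hya
      exact hx ⟨⟨(y, a), ha⟩, hya, rfl⟩)
  filter_upwards [hU.mem_nhds (hxU rfl), upperHemicontinuous_iff_forall_isOpen.1 hΓ x W hW hΓW]
    with y hyU hyW
  rintro ⟨⟨⟨y', a⟩, ha⟩, hmem, rfl⟩
  exact hUW ⟨hyU, hyW ha⟩ hmem

lemma lowerSemicontinuous_fiberInf (hΓ : UpperHemicontinuous Γ) (hc : ∀ x, IsCompact (Γ x))
    {f : {p : X × A // p.2 ∈ Γ p.1} → ℝ≥0∞} (hf : LowerSemicontinuous f) :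
    LowerSemicontinuous (fiberInf Γ f) := by
  rw [lowerSemicontinuous_iff_isClosed_preimage]
  intro t
  rcases eq_or_ne t ∞ with rfl | ht
  · simp
  convert isClosed_image_graph hΓ hc (hf.isClosed_preimage t) using 1
  ext x
  constructor
  · intro hx
    have hne : (Γ x).Nonempty := by
      by_contra h
      have : IsEmpty (Γ x) := Set.isEmpty_coe_sort.2 (Set.not_nonempty_iff_eq_empty.1 h)
      have hx' : fiberInf Γ f x ≤ t := hx
      rw [fiberInf, iInf_of_empty] at hx'
      exact ht (top_le_iff.1 hx')
    obtain ⟨a, ha⟩ := exists_eq_fiberInf hc hf hne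
    exact ⟨⟨(x, a.1), a.2⟩, ha.trans_le hx, rfl⟩
  · rintro ⟨k, hk, rfl⟩
    exact (fiberInf_le f k).trans hk

/-- Over compact fibres, minimization commutes with increasing limits of lower semicontinuous
functions. -/
lemma fiberInf_iSup (hc : ∀ x, IsCompact (Γ x)) {f : ℕ → {p : X × A // p.2 ∈ Γ p.1} → ℝ≥0∞}
    (hf : ∀ m, LowerSemicontinuous (f m)) (hmono : Monotone f) {x : X} (hne : (Γ x).Nonempty) :
    fiberInf Γ (fun k => ⨆ m, f m k) x = ⨆ m, fiberInf Γ (f m) x := by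
  apply le_antisymm
  · set t := ⨆ m, fiberInf Γ (f m) x with ht
    have := isCompact_iff_compactSpace.1 (hc x)
    have hclosed : ∀ m, IsClosed {a : Γ x | f m ⟨(x, a.1), a.2⟩ ≤ t} := fun m =>
      (lowerSemicontinuous_fiber (hf m) x).isClosed_preimage t
    obtain ⟨a, ha⟩ := IsCompact.nonempty_iInter_of_sequence_nonempty_isCompact_isClosed
      (fun m => {a : Γ x | f m ⟨(x, a.1), a.2⟩ ≤ t})
      (fun m a ha => (hmono (Nat.le_succ m) _).trans ha)
      (fun m => by
        obtain ⟨a, ha⟩ := exists_eq_fiberInf hc (hf m) hne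
        exact ⟨a, ha.trans_le (le_iSup (fun m => fiberInf Γ (f m) x) m)⟩)
      (hclosed 0).isCompact hclosed
    exact (iInf_le _ a).trans (iSup_le fun m => Set.mem_iInter.1 ha m)
  · exact iSup_le fun m => fiberInf_mono (fun k => le_iSup (fun m => f m k) m) x

/-- A lower semicontinuous function on the graph has a measurable minimizer. The set of minimizers
hits a closed set `C` exactly if some admissible action lies in `C` and the minimum over the
actions in `C` does not exceed the unrestricted one; both minima are lower semicontinuous. -/
lemma exists_measurable_minimizer [MeasurableSpace X] [BorelSpace X]
    [TopologicalSpace.MetrizableSpace A] [TopologicalSpace.SeparableSpace A] [MeasurableSpace A]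
    [BorelSpace A] (hΓ : UpperHemicontinuous Γ) (hc : ∀ x, IsCompact (Γ x))
    (hne : ∀ x, (Γ x).Nonempty) {f : {p : X × A // p.2 ∈ Γ p.1} → ℝ≥0∞}
    (hf : LowerSemicontinuous f) :
    ∃ s : X → A, Measurable s ∧ ∀ x, ∃ h : s x ∈ Γ x, f ⟨(x, s x), h⟩ = fiberInf Γ f x := by
  classical
  let := TopologicalSpace.metrizableSpaceMetric A
  let D : X → Set A := fun x =>
    Subtype.val '' {a : Γ x | f ⟨(x, a.1), a.2⟩ ≤ fiberInf Γ f x}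
  have hD : ∀ x, IsCompact (D x) := fun x => by
    have := isCompact_iff_compactSpace.1 (hc x)
    exact ((lowerSemicontinuous_fiber hf x).isClosed_preimage _).isCompact.image
      continuous_subtype_val
  have hDne : ∀ x, (D x).Nonempty := fun x => by
    obtain ⟨a, ha⟩ := exists_eq_fiberInf hc hf (hne x)
    exact ⟨a, a, ha.le, rfl⟩
  obtain ⟨s, hs, hsD⟩ := exists_measurable_selection hD hDne fun C hC => by
    have hC' : IsClosed {k : {p : X × A // p.2 ∈ Γ p.1} | k.1.2 ∈ C} :=
      hC.preimage (continuous_snd.comp continuous_subtype_val)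
    let g : {p : X × A // p.2 ∈ Γ p.1} → ℝ≥0∞ := fun k => if k.1.2 ∈ C then f k else ∞
    have hg : LowerSemicontinuous g := by
      rw [lowerSemicontinuous_iff_isClosed_preimage]
      intro t
      rcases eq_or_ne t ∞ with rfl | ht
      · simp
      convert hC'.inter (hf.isClosed_preimage t) using 1
      ext k
      by_cases hk : k.1.2 ∈ C <;> simp [g, hk, ht]
    have : {x | (D x ∩ C).Nonempty} = (fun k : {p : X × A // p.2 ∈ Γ p.1} => k.1.1) ''
        {k | k.1.2 ∈ C} ∩ {x | fiberInf Γ g x ≤ fiberInf Γ f x} := by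
      ext x
      constructor
      · rintro ⟨_, ⟨a, ha, rfl⟩, haC⟩
        refine ⟨⟨⟨(x, a.1), a.2⟩, haC, rfl⟩, (fiberInf_le g ⟨(x, a.1), a.2⟩).trans ?_⟩
        simpa [g, haC] using ha
      · rintro ⟨⟨⟨⟨x', a⟩, ha⟩, haC, rfl⟩, hle⟩
        obtain ⟨b, hb⟩ := exists_eq_fiberInf hc hg ⟨a, ha⟩
        by_cases hbC : b.1 ∈ C
        · refine ⟨b.1, ⟨b, ?_, rfl⟩, hbC⟩
          have hb' : f ⟨(x', b.1), b.2⟩ = fiberInf Γ g x' := by rw [← hb]; simp [g, hbC]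
          exact hb'.trans_le hle
        · have htop : fiberInf Γ f x' = ∞ := by
            refine top_le_iff.1 (le_trans (le_of_eq ?_) hle)
            rw [← hb]; simp [g, hbC]
          exact ⟨a, ⟨⟨a, ha⟩, by simp [htop], rfl⟩, haC⟩
    rw [this]
    exact (isClosed_image_graph hΓ hc hC').measurableSet.inter
      (measurableSet_le (lowerSemicontinuous_fiberInf hΓ hc hg).measurable
        (lowerSemicontinuous_fiberInf hΓ hc hf).measurable)
  refine ⟨s, hs, fun x => ?_⟩
  obtain ⟨a, ha, has⟩ := hsD x
  have hmem : s x ∈ Γ x := has ▸ a.2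
  refine ⟨hmem, le_antisymm ?_ (fiberInf_le f ⟨(x, s x), hmem⟩)⟩
  have : (⟨(x, s x), hmem⟩ : {p : X × A // p.2 ∈ Γ p.1}) = ⟨(x, a.1), a.2⟩ := by
    simp [has]
  rw [this]
  exact ha

end Minimization

namespace ControlModel

set_option linter.unusedSectionVars false

variable {X A S Ω : ℕ → Type*}
  [∀ n, TopologicalSpace (X n)] [∀ n, MeasurableSpace (X n)]
  [∀ n, TopologicalSpace (A n)] [∀ n, MeasurableSpace (A n)]
  [∀ n, TopologicalSpace (S n)] [∀ n, MeasurableSpace (S n)]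
  [∀ n, MeasurableSpace (Ω n)]
  {M : ControlModel X A S Ω} {ρ : ∀ n, CondRiskMapping (M.K n) (M.P n)} {γ : ℝ≥0}

/-! ### Value iteration -/

lemma stepCost_mono {n : ℕ} {v w : X (n + 1) → ℝ≥0∞} (h : ∀ y, v y ≤ w y) (k : M.K n) :
    M.stepCost ρ γ n v k ≤ M.stepCost ρ γ n w k := by
  rw [stepCost, stepCost]
  gcongr
  exact (ρ n).eval_mono (Eventually.of_forall fun ω => h _)

/-- Value iteration: the optimal values of the finite horizon problems without terminal cost. -/
noncomputable def valueIter (M : ControlModel X A S Ω)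
    (ρ : ∀ n, CondRiskMapping (M.K n) (M.P n)) (γ : ℝ≥0) : (m n : ℕ) → X n → ℝ≥0∞
  | 0, _, _ => 0
  | m + 1, n, x => fiberInf (M.adm n) (M.stepCost ρ γ n (M.valueIter ρ γ m (n + 1))) x

/-- The limit of value iteration. -/
noncomputable def valueLim (M : ControlModel X A S Ω)
    (ρ : ∀ n, CondRiskMapping (M.K n) (M.P n)) (γ : ℝ≥0) (n : ℕ) (x : X n) : ℝ≥0∞ :=
  ⨆ m, M.valueIter ρ γ m n x

lemma valueIter_monotone (n : ℕ) : Monotone fun m => M.valueIter ρ γ m n := by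
  suffices h : ∀ m n x, M.valueIter ρ γ m n x ≤ M.valueIter ρ γ (m + 1) n x from
    monotone_nat_of_le_succ fun m x => h m n x
  intro m
  induction m with
  | zero => intro n x; exact bot_le
  | succ m ih => exact fun n x => fiberInf_mono (stepCost_mono (ih (n + 1))) x

lemma valueLim_le_of_isSolution {v : ∀ n, X n → ℝ≥0∞} (hv : M.IsSolution ρ γ v) (n : ℕ)
    (x : X n) : M.valueLim ρ γ n x ≤ v n x := by
  refine iSup_le fun m => ?_
  induction m generalizing n with
  | zero => exact bot_le
  | succ m ih =>
    rw [hv.2]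
    exact fiberInf_mono (stepCost_mono (ih (n + 1))) x

lemma valueLim_le_V (π : M.Policy) (n : ℕ) (x : X n) :
    M.valueLim ρ γ n x ≤ M.V ρ γ π n x := by
  suffices h : ∀ m n x, M.valueIter ρ γ m n x ≤ M.truncCost ρ γ π m n x from
    iSup_mono fun m => h m n x
  intro m
  induction m with
  | zero => intro n x; exact bot_le
  | succ m ih =>
    exact fun n x => (fiberInf_le _ (π.pair n x)).trans (stepCost_mono (ih (n + 1)) _)

/-- Every supersolution of the evaluation equation of a policy dominates the cost of the policy. -/
lemma V_le_of_stepCost_le {π : M.Policy} {w : ∀ n, X n → ℝ≥0∞}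
    (hw : ∀ n x, M.stepCost ρ γ n (w (n + 1)) (π.pair n x) ≤ w n x) (n : ℕ) (x : X n) :
    M.V ρ γ π n x ≤ w n x := by
  refine iSup_le fun m => ?_
  induction m generalizing n with
  | zero => exact le_self_add.trans (hw n x)
  | succ m ih => exact (stepCost_mono (ih (n + 1)) _).trans (hw n x)

/-! ### Replacing one noise variable -/

lemma state_update (π : M.Policy) (x₀ : X 0) (ω : ∀ i, Ω i) {n : ℕ} (y : Ω n) {m : ℕ}
    (hm : m ≤ n) : M.state π x₀ m (Function.update ω n y) = M.state π x₀ m ω := by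
  induction m with
  | zero => rfl
  | succ m ih =>
    rw [state, state, ih (Nat.le_of_succ_le hm),
      Function.update_of_ne (Nat.ne_of_lt hm)]

/-- Replacing one coordinate of a sequence of independent random elements by an independent copy
does not change the joint law. -/
lemma map_update_infinitePi (P : ∀ n, Measure (Ω n)) [∀ n, IsProbabilityMeasure (P n)] (n : ℕ) :
    ((Measure.infinitePi P).prod (P n)).map (fun p => Function.update p.1 n p.2) =
      Measure.infinitePi P := by
  refine Measure.eq_infinitePi P fun s t ht => ?_
  rw [Measure.map_apply measurable_update' (MeasurableSet.pi s.countable_toSet fun i _ => ht i)]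
  by_cases hn : n ∈ s
  · have : (fun p : (∀ i, Ω i) × Ω n => Function.update p.1 n p.2) ⁻¹' Set.pi s t =
        Set.pi (s.erase n) t ×ˢ t n := by
      ext p
      simp only [Set.mem_preimage, Set.mem_pi, Set.mem_prod, Finset.mem_coe, Finset.mem_erase]
      constructor
      · intro h
        refine ⟨fun i hi => ?_, by simpa using h n hn⟩
        simpa [Function.update_of_ne hi.1] using h i hi.2
      · rintro ⟨h1, h2⟩ i hi
        rcases eq_or_ne i n with rfl | hin
        · simpa using h2
        · simpa [Function.update_of_ne hin] using h1 i ⟨hin, hi⟩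
    rw [this, Measure.prod_prod, Measure.infinitePi_pi _ fun i _ => ht i,
      Finset.prod_erase_mul _ _ hn]
  · have : (fun p : (∀ i, Ω i) × Ω n => Function.update p.1 n p.2) ⁻¹' Set.pi s t =
        Set.pi s t ×ˢ Set.univ := by
      ext p
      simp only [Set.mem_preimage, Set.mem_pi, Set.mem_prod, Finset.mem_coe, Set.mem_univ,
        and_true]
      refine forall₂_congr fun i hi => ?_
      rw [Function.update_of_ne (ne_of_mem_of_not_mem hi hn)]
    rw [this, Measure.prod_prod, Measure.infinitePi_pi _ fun i _ => ht i, measure_univ, mul_one]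

/-! ### Regularity of the one-step operator -/

lemma continuous_next (M : ControlModel X A S Ω) (n : ℕ) (ω : Ω n) :
    Continuous fun k => M.next n k ω :=
  (M.continuous_F n).comp (continuous_id.prodMk continuous_const)

lemma Policy.measurable_pair (π : M.Policy) (n : ℕ) : Measurable (π.pair n) :=
  (measurable_id.prodMk (π.measurable_rule n)).subtype_mk

variable [∀ n, BorelSpace (X n)] [∀ n, BorelSpace (S n)]

lemma measurable_next (M : ControlModel X A S Ω) (n : ℕ) (k : M.K n) :
    Measurable (M.next n k) :=
  ((M.continuous_F n).comp (continuous_const.prodMk continuous_id)).measurable.comp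
    (M.measurable_ξ n)

lemma stepCost_iSup (hρ : ∀ n, (ρ n).LawInvariant) {n : ℕ} {v : ℕ → X (n + 1) → ℝ≥0∞}
    (hv : ∀ m, Measurable (v m)) (hmono : Monotone v) (k : M.K n) :
    M.stepCost ρ γ n (fun y => ⨆ m, v m y) k = ⨆ m, M.stepCost ρ γ n (v m) k := by
  have := M.isProbabilityMeasure_P
  apply le_antisymm
  · simp only [stepCost]
    rw [← ENNReal.add_iSup, ← ENNReal.mul_iSup]
    gcongr
    simp only [(hρ n).eval_eq_upperExt k]
    exact ((ρ n).isCoherent_slice k).upperExt_iSup_le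
      (fun m => (hv m).comp (M.measurable_next n k)) fun a b h ω => hmono h _
  · exact iSup_le fun m => stepCost_mono (fun y => le_iSup (fun m => v m y) m) k

/-- Positivity of `γ` matters here: for `γ = 0` the product with an infinite risk is `0`. -/
lemma ae_lt_top_of_stepCost_lt_top (hρ : ∀ n, (ρ n).LawInvariant) (hγ : 0 < γ) {n : ℕ}
    {v : X (n + 1) → ℝ≥0∞} (hv : Measurable v) {k : M.K n}
    (h : M.stepCost ρ γ n v k < ∞) : ∀ᵐ ω ∂(M.P n), v (M.next n k ω) < ∞ := by
  have := M.isProbabilityMeasure_P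
  refine ((ρ n).isCoherent_slice k).ae_lt_top_of_upperExt_lt_top (M.atomless_P n)
    (fun f g => (hρ n).slice_eq k) (hv.comp (M.measurable_next n k)) ?_
  rw [← (hρ n).eval_eq_upperExt k (fun k ω => v (M.next n k ω)) k]
  by_contra htop
  rw [stepCost, not_lt_top_iff.1 htop, ENNReal.mul_top (by simpa using hγ.ne')] at h
  simp at h

variable [∀ n, PolishSpace (X n)] [∀ n, PolishSpace (A n)] [∀ n, BorelSpace (A n)]

lemma measurable_uncurry_next (M : ControlModel X A S Ω) (n : ℕ) :
    Measurable (Function.uncurry (M.next n)) :=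
  have : TopologicalSpace.MetrizableSpace (M.K n) :=
    Topology.IsEmbedding.subtypeVal.metrizableSpace
  measurable_uncurry_of_continuous_of_measurable (M.continuous_next n) (M.measurable_next n)

/-- Lower semicontinuity of the one-step operator: along a convergent sequence of feasible pairs
the next states converge for every fixed noise, and Fatou's lemma applies. -/
lemma lowerSemicontinuous_stepCost (hρ : ∀ n, (ρ n).LawInvariant)
    (hc : ∀ n, LowerSemicontinuous (M.c n)) {n : ℕ} {v : X (n + 1) → ℝ≥0∞}
    (hv : LowerSemicontinuous v) : LowerSemicontinuous (M.stepCost ρ γ n v) := by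
  have := M.isProbabilityMeasure_P
  have h1 : LowerSemicontinuous fun k : M.K n => (M.c n k : ℝ≥0∞) :=
    ENNReal.continuous_coe.comp_lowerSemicontinuous (hc n) fun _ _ h => ENNReal.coe_le_coe.2 h
  have h2 : LowerSemicontinuous ((ρ n).eval fun k ω => v (M.next n k ω)) := by
    rw [lowerSemicontinuous_iff_isClosed_preimage]
    intro t
    refine IsSeqClosed.isClosed fun u k hu hlim => ?_
    have hρk := (hρ n).eval_eq_upperExt k fun k ω => v (M.next n k ω)
    simp only [Set.mem_preimage, Set.mem_Iic, hρk] at hu ⊢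
    refine ((ρ n).isCoherent_slice k).upperExt_le_of_le_liminf
      (fun j => hv.measurable.comp (M.measurable_next n (u j))) (fun ω => ?_) hu
    exact (hv.le_liminf _).trans
      (liminf_le_liminf_of_le (((M.continuous_next n ω).tendsto k).comp hlim))
  exact h1.add ((ENNReal.continuous_const_mul ENNReal.coe_ne_top).comp_lowerSemicontinuous h2
    fun _ _ h => mul_le_mul_right h _)

/-! ### The optimality equation for the limit of value iteration -/

lemma lowerSemicontinuous_valueIter (hρ : ∀ n, (ρ n).LawInvariant)
    (hc : ∀ n, LowerSemicontinuous (M.c n)) (husc : ∀ n, UpperHemicontinuous (M.adm n))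
    (hcompact : ∀ n x, IsCompact (M.adm n x)) (m n : ℕ) :
    LowerSemicontinuous (M.valueIter ρ γ m n) := by
  induction m generalizing n with
  | zero => exact lowerSemicontinuous_const
  | succ m ih =>
    exact lowerSemicontinuous_fiberInf (husc n) (hcompact n)
      (lowerSemicontinuous_stepCost hρ hc (ih (n + 1)))

lemma lowerSemicontinuous_valueLim (hρ : ∀ n, (ρ n).LawInvariant)
    (hc : ∀ n, LowerSemicontinuous (M.c n)) (husc : ∀ n, UpperHemicontinuous (M.adm n))
    (hcompact : ∀ n x, IsCompact (M.adm n x)) (n : ℕ) :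
    LowerSemicontinuous (M.valueLim ρ γ n) :=
  lowerSemicontinuous_iSup fun m => lowerSemicontinuous_valueIter hρ hc husc hcompact m n

lemma valueLim_eq_fiberInf (hρ : ∀ n, (ρ n).LawInvariant)
    (hc : ∀ n, LowerSemicontinuous (M.c n)) (husc : ∀ n, UpperHemicontinuous (M.adm n))
    (hcompact : ∀ n x, IsCompact (M.adm n x)) (hne : ∀ n x, (M.adm n x).Nonempty) (n : ℕ)
    (x : X n) :
    M.valueLim ρ γ n x = fiberInf (M.adm n) (M.stepCost ρ γ n (M.valueLim ρ γ (n + 1))) x := by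
  have hlsc := lowerSemicontinuous_valueIter (γ := γ) hρ hc husc hcompact
  have h1 : M.stepCost ρ γ n (M.valueLim ρ γ (n + 1)) =
      fun k => ⨆ m, M.stepCost ρ γ n (M.valueIter ρ γ m (n + 1)) k := by
    funext k
    exact stepCost_iSup hρ (fun m => (hlsc m (n + 1)).measurable) (valueIter_monotone (n + 1)) k
  rw [h1, fiberInf_iSup (hcompact n)
    (fun m => lowerSemicontinuous_stepCost hρ hc (hlsc m (n + 1)))
    (fun a b h => stepCost_mono (valueIter_monotone (n + 1) h)) (hne n x)]
  -- The value iteration from `0` on and from `1` on has the same supremum.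
  refine le_antisymm (iSup_le fun m => ?_) (iSup_le fun m => ?_)
  · exact (valueIter_monotone n (Nat.le_succ m) x).trans
      (le_iSup (fun m => fiberInf (M.adm n) (M.stepCost ρ γ n (M.valueIter ρ γ m (n + 1))) x) m)
  · exact le_iSup (fun m => M.valueIter ρ γ m n x) (m + 1)

lemma exists_policy_stepCost_eq_valueLim (hρ : ∀ n, (ρ n).LawInvariant)
    (hc : ∀ n, LowerSemicontinuous (M.c n)) (husc : ∀ n, UpperHemicontinuous (M.adm n))
    (hcompact : ∀ n x, IsCompact (M.adm n x)) (hne : ∀ n x, (M.adm n x).Nonempty) :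
    ∃ π : M.Policy, ∀ n x,
      M.stepCost ρ γ n (M.valueLim ρ γ (n + 1)) (π.pair n x) = M.valueLim ρ γ n x := by
  choose s hs hsΓ hmin using fun n => exists_measurable_minimizer (husc n) (hcompact n) (hne n)
    (lowerSemicontinuous_stepCost (ρ := ρ) (γ := γ) hρ hc
      (lowerSemicontinuous_valueLim hρ hc husc hcompact (n + 1)))
  exact ⟨⟨s, hs, hsΓ⟩, fun n x =>
    (hmin n x).trans (valueLim_eq_fiberInf hρ hc husc hcompact hne n x).symm⟩

/-! ### Almost sure properties of the state process -/

lemma measurable_state (π : M.Policy) (x₀ : X 0) (n : ℕ) : Measurable (M.state π x₀ n) := by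
  induction n with
  | zero => exact measurable_const
  | succ n ih =>
    exact (M.measurable_uncurry_next n).comp
      (((π.measurable_pair n).comp ih).prodMk (measurable_pi_apply n))

/-- A property of states that is inherited, almost surely, by the next state holds almost surely
along the whole state process. -/
lemma ae_state_mem (π : M.Policy) {x₀ : X 0} {G : ∀ n, Set (X n)}
    (hG : ∀ n, MeasurableSet (G n)) (h0 : x₀ ∈ G 0)
    (hstep : ∀ n, ∀ x ∈ G n, ∀ᵐ y ∂(M.P n), M.next n (π.pair n x) y ∈ G (n + 1)) (n : ℕ) :
    ∀ᵐ ω ∂(Measure.infinitePi M.P), M.state π x₀ n ω ∈ G n := by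
  have := M.isProbabilityMeasure_P
  induction n with
  | zero => exact Eventually.of_forall fun _ => h0
  | succ n ih =>
    have hset : MeasurableSet {ω : ∀ i, Ω i | M.state π x₀ (n + 1) ω ∈ G (n + 1)} :=
      measurable_state π x₀ (n + 1) (hG (n + 1))
    -- The state at time `n` does not depend on the noise at time `n`, which may thus be resampled.
    rw [← map_update_infinitePi M.P n, ae_map_iff measurable_update'.aemeasurable hset,
      Measure.ae_prod_iff_ae_ae (p := fun p => M.state π x₀ (n + 1) (Function.update p.1 n p.2) ∈
        G (n + 1)) (measurable_update' hset)]
    filter_upwards [ih] with ω hω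
    filter_upwards [hstep n _ hω] with y hy
    simpa only [state, state_update π x₀ ω y le_rfl, Function.update_self] using hy

end ControlModel

end RobustControl

theorem theorem3p1 {X A S Ω : ℕ → Type*}
    [∀ n, TopologicalSpace (X n)] [∀ n, PolishSpace (X n)]
    [∀ n, MeasurableSpace (X n)] [∀ n, BorelSpace (X n)]
    [∀ n, TopologicalSpace (A n)] [∀ n, PolishSpace (A n)]
    [∀ n, MeasurableSpace (A n)] [∀ n, BorelSpace (A n)]
    [∀ n, TopologicalSpace (S n)] [∀ n, MeasurableSpace (S n)] [∀ n, BorelSpace (S n)]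
    [∀ n, MeasurableSpace (Ω n)]
    (M : RobustControl.ControlModel X A S Ω)
    (ρ : ∀ n, RobustControl.CondRiskMapping (M.K n) (M.P n))
    (hρ : ∀ n, (ρ n).LawInvariant)
    (γ : ℝ≥0) (hγ0 : 0 < γ) (hγ1 : γ < 1)
    (hQ : M.WeaklyContinuous)
    (hc : ∀ n, LowerSemicontinuous (M.c n))
    (husc : ∀ n, UpperHemicontinuous (M.adm n))
    (hcompact : ∀ n x, IsCompact (M.adm n x))
    (x₀ : X 0)
    (hfinite : ∃ π : M.Policy, M.Admissible ρ γ x₀ π ∧ M.V ρ γ π 0 x₀ < ∞) :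
    IsLeast {v | M.IsSolution ρ γ v} (M.Vstar ρ γ x₀) ∧
      ∃ π : M.Policy, M.Admissible ρ γ x₀ π ∧
        (∀ n x, M.Vstar ρ γ x₀ n x =
          M.stepCost ρ γ n (M.Vstar ρ γ x₀ (n + 1)) (π.pair n x)) ∧
        ∀ n x, M.V ρ γ π n x = M.Vstar ρ γ x₀ n x := by

  obtain ⟨π₀, hπ₀, hπ₀fin⟩ := hfinite
  have hne : ∀ n x, (M.adm n x).Nonempty := fun n x => ⟨π₀.rule n x, π₀.feasible n x⟩
  have hlsc := RobustControl.ControlModel.lowerSemicontinuous_valueLim (γ := γ) hρ hc husc hcompact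
  obtain ⟨π, hπ⟩ := RobustControl.ControlModel.exists_policy_stepCost_eq_valueLim (γ := γ)
    hρ hc husc hcompact hne
  have hV : ∀ n x, M.V ρ γ π n x = M.valueLim ρ γ n x := fun n x =>
    (RobustControl.ControlModel.V_le_of_stepCost_le (fun n x => (hπ n x).le) n x).antisymm
      (RobustControl.ControlModel.valueLim_le_V π n x)
  -- The value at `x₀` is finite, and finite values propagate along the state process.
  have hadm : M.Admissible ρ γ x₀ π := fun n => by
    simp only [hV]
    refine RobustControl.ControlModel.ae_state_mem π (G := fun n => {x | M.valueLim ρ γ n x < ∞})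
      (fun n => measurableSet_lt (hlsc n).measurable measurable_const)
      ((RobustControl.ControlModel.valueLim_le_V π₀ 0 x₀).trans_lt hπ₀fin) (fun n x hx => ?_) n
    exact RobustControl.ControlModel.ae_lt_top_of_stepCost_lt_top hρ hγ0 (hlsc (n + 1)).measurable
      ((hπ n x).trans_lt hx)
  have hstar : M.Vstar ρ γ x₀ = M.valueLim ρ γ := by
    funext n x
    exact le_antisymm (iInf₂_le_of_le π hadm (hV n x).le)
      (le_iInf₂ fun π' _ => RobustControl.ControlModel.valueLim_le_V π' n x)
  rw [hstar]
  refine ⟨⟨⟨fun n => (hlsc n).measurable, fun n x => ?_⟩, fun v hv n x => ?_⟩, π, hadm,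
    fun n x => (hπ n x).symm, hV⟩
  · exact RobustControl.ControlModel.valueLim_eq_fiberInf hρ hc husc hcompact hne n x
  · exact RobustControl.ControlModel.valueLim_le_of_isSolution hv n x
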